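/- Let $\Gamma$ be a group of type $FP_\infty(\mathbb{Q})$ and let $P_\bullet\to\mathbb{C}$ be the complexification of a based resolution of the trivial module $\mathbb{Q}$ by finitely generated free left $\mathbb{Q}\Gamma$-modules, with boundary maps $d_k\colon P_k\to P_{k-1}$ ($k\ge 1$) and $d_0=0$. Let $m_k$ be the rank of $P_k$. Let $(\sum a_\gamma\gamma)^*=\sum \overline{a_\gamma}\gamma^{-1}$ be the involution of $\mathbb{C}\Gamma$, let $d_k^*\colon P_{k-1}\to P_k$ be the formal adjoint of $d_k$, given by the conjugate-transposed matrix, and let $\Delta_n=d_n^*d_n+d_{n+1}d_{n+1}^*\colon P_n\to P_n$ be the Laplace operator. For a $\mathbb{C}\Gamma$-module $V$, let $H^\bullet(\Gamma,V)$ be the cohomology of $\hom_{\mathbb{C}\Gamma}(P_\bullet,V)$ and $H_\bullet(\Gamma,V)$ the homology of $V\otimes_{\mathbb{C}\Gamma}P_\bullet$, where $V$ is regarded as a right module through the involution; put $H_{-1}(\Gamma,V)=0$. The bases identify both $\hom_{\mathbb{C}\Gamma}(P_k,V)$ and $V\otimes_{\mathbb{C}\Gamma}P_k$ with $V^{m_k}$.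 If $V$ is a Banach space on which $\Gamma$ acts by bounded operators, then $H^\bullet(\Gamma,V)$ and $H_\bullet(\Gamma,V)$ carry the topologies induced from the product topologies on $V^{m_k}$ (the quotient topologies of the subspace topologies on (co)cycles), and $\bar H^\bullet(\Gamma,V)$, $\bar H_\bullet(\Gamma,V)$ denote their quotients by the closure of $\{0\}$. Let $A$ be a unital $C^*$-algebra with a unital $*$-homomorphism $\mathbb{C}\Gamma\to A$; every (unital) $A$-module is a $\mathbb{C}\Gamma$-module through it. Let $\Delta_n^A=\operatorname{id}_A\otimes\Delta_n$ be the induced $A$-linear endomorphism of the free left $A$-module $A\otimes_{\mathbb{C}\Gamma}P_n$. For every integer $n\ge 0$ the following conditions are equivalent. 1. The Laplace operator $\Delta_n^A$ is invertible as an $A$-linear map. 2. For every (unital) Hilbert $*$-representation $V$ of $A$, $\bar H^n(\Gamma,V)=0$. 3. For every Hilbert $*$-representation $V$ of $A$, $H^n(\Gamma,V)=0$. 4. For every Hilbert $*$-representation $V$ of $A$, $H^n(\Gamma,V)=0$ and $H^{n+1}(\Gamma,V)$ is Hausdorff. 5. For every $A$-module $V$, $H^n(\Gamma,V)=0$. 6.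 $H^n(\Gamma,A)=0$ and $H^{n+1}(\Gamma,A)$ is Hausdorff. They are also equivalent to each of the following homological conditions. - (2') For every Hilbert $*$-representation $V$ of $A$, $\bar H_n(\Gamma,V)=0$. - (3') For every Hilbert $*$-representation $V$ of $A$, $H_n(\Gamma,V)=0$. - (4') For every Hilbert $*$-representation $V$ of $A$, $H_n(\Gamma,V)=0$ and $H_{n-1}(\Gamma,V)$ is Hausdorff. - (5') For every $A$-module $V$, $H_n(\Gamma,V)=0$. - (6') $H_n(\Gamma,A)=0$ and $H_{n-1}(\Gamma,A)$ is Hausdorff. Moreover, these equivalent conditions imply that for every Banach $A$-module $V$ (a complex Banach space with a unital $A$-module structure, compatible with the scalars, in which each element of $A$ acts by a bounded operator), - (7) $H^{n+1}(\Gamma,V)$ is Hausdorff, and - (7') $H_{n-1}(\Gamma,V)$ is Hausdorff. -/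

import Mathlib

universe u v

/-! ### The group algebra `ℂΓ` as a `*`-algebra -/

section GroupAlgebra

variable {Γ : Type*} [Group Γ]

/-- The involution of the group algebra: `(∑ a_γ γ)^* = ∑ conj(a_γ) γ⁻¹`. -/
noncomputable instance groupAlgebraStar : Star (MonoidAlgebra ℂ Γ) where
  star x := x.coeff.sum fun γ a => MonoidAlgebra.single γ⁻¹ (starRingEnd ℂ a)

theorem groupAlgebra_star_single (γ : Γ) (a : ℂ) :
    star (MonoidAlgebra.single γ a) = MonoidAlgebra.single γ⁻¹ (starRingEnd ℂ a) := by
  change (MonoidAlgebra.single γ a).coeff.sum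
    (fun γ a => MonoidAlgebra.single γ⁻¹ (starRingEnd ℂ a)) = _
  rw [MonoidAlgebra.coeff_single, Finsupp.sum_single_index]
  simp

/-- The augmentation `ℚΓ → ℚ`, `γ ↦ 1`. -/
noncomputable def groupAlgebraAug (Γ : Type*) [Group Γ] : MonoidAlgebra ℚ Γ →+* ℚ :=
  (MonoidAlgebra.lift ℚ ℚ Γ (1 : Γ →* ℚ)).toRingHom

end GroupAlgebra

/-- A based resolution `0 ← ℚ ← P₀ ← P₁ ← ⋯` of the trivial module `ℚ` by finitely generated free
left `ℚΓ`-modules; the `n`-th module is `(ℚΓ)^(rank n)` with its standard basis. The map `d n` is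
the boundary map from degree `n + 1` to degree `n`. The map to `ℚ` is `ℚΓ`-linear for the trivial
action on `ℚ`, that is, semilinear along the augmentation. -/
structure FreeResolution (Γ : Type*) [Group Γ] where
  rank : ℕ → ℕ
  d : ∀ n : ℕ, (Fin (rank (n + 1)) → MonoidAlgebra ℚ Γ) →ₗ[MonoidAlgebra ℚ Γ]
    (Fin (rank n) → MonoidAlgebra ℚ Γ)
  aug : (Fin (rank 0) → MonoidAlgebra ℚ Γ) →ₛₗ[groupAlgebraAug Γ] ℚ
  aug_surjective : Function.Surjective aug
  exact_zero : Function.Exact (d 0) aug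
  exact_succ : ∀ n : ℕ, Function.Exact (d (n + 1)) (d n)

/-- A matrix over a ring `R` acting on column vectors with entries in a left `R`-module `V`. -/
def matrixAct {R : Type*} [Ring R] (V : Type*) [AddCommGroup V] [Module R V] {k l : ℕ}
    (M : Matrix (Fin k) (Fin l) R) : (Fin l → V) →+ (Fin k → V) where
  toFun v i := ∑ j, M i j • v j
  map_zero' := by ext i; simp
  map_add' v w := by ext i; simp [Finset.sum_add_distrib]

namespace FreeResolution

variable {Γ : Type*} [Group Γ] (P : FreeResolution Γ)

/-- The matrix over `ℂΓ` of the boundary map from degree `n + 1` to degree `n` of the complexified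
resolution: `d(e_i) = ∑_j (mat n) i j • e_j`. -/
noncomputable def mat (n : ℕ) :
    Matrix (Fin (P.rank (n + 1))) (Fin (P.rank n)) (MonoidAlgebra ℂ Γ) :=
  Matrix.of fun i j =>
    MonoidAlgebra.mapRingHom Γ (algebraMap ℚ ℂ) (P.d n (Pi.single i 1) j)

section Coefficients

/-! #### Cohomology and homology with coefficients

The coefficients are an `R`-module `V`, made a `ℂΓ`-module through a ring homomorphism
`f : ℂΓ → R`. -/

variable {R : Type*} [Ring R] (f : MonoidAlgebra ℂ Γ →+* R)
variable (V : Type*) [AddCommGroup V] [Module R V]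

/-- The coboundary map `Hom(P_n, V) → Hom(P_{n+1}, V)`, where `Hom(P_n, V)` is identified with
`V^(rank n)` by evaluation at the basis. -/
noncomputable def cobdry (n : ℕ) : (Fin (P.rank n) → V) →+ (Fin (P.rank (n + 1)) → V) :=
  matrixAct V ((P.mat n).map f)

/-- The boundary map `V ⊗ P_{n+1} → V ⊗ P_n`, where `V` is a right `ℂΓ`-module through the
involution (`v · x = x^* v`) and `V ⊗ P_n` is identified with `V^(rank n)` by the basis:
`v ⊗ e_i ↦ v ⊗ d e_i = ∑_j ((mat n) i j)^* v ⊗ e_j`. -/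
noncomputable def bdry (n : ℕ) : (Fin (P.rank (n + 1)) → V) →+ (Fin (P.rank n) → V) :=
  matrixAct V ((P.mat n).conjTranspose.map f)

/-- The `n`-cocycles. -/
noncomputable def cocycles (n : ℕ) : AddSubgroup (Fin (P.rank n) → V) :=
  (P.cobdry f V n).ker

/-- The `n`-coboundaries. -/
noncomputable def coboundaries : (n : ℕ) → AddSubgroup (Fin (P.rank n) → V)
  | 0 => ⊥
  | n + 1 => (P.cobdry f V n).range

/-- The `n`-cycles. -/
noncomputable def cycles : (n : ℕ) → AddSubgroup (Fin (P.rank n) → V)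
  | 0 => ⊤
  | n + 1 => (P.bdry f V n).ker

/-- The `n`-boundaries. -/
noncomputable def boundaries (n : ℕ) : AddSubgroup (Fin (P.rank n) → V) :=
  (P.bdry f V n).range

/-- The cohomology group `H^n(Γ, V)`. If `V` has a topology, it carries the quotient topology
of the subspace topology on cocycles. -/
abbrev Cohomology (n : ℕ) : Type _ :=
  P.cocycles f V n ⧸ (P.coboundaries f V n).addSubgroupOf (P.cocycles f V n)

/-- The homology group `H_n(Γ, V)`. If `V` has a topology, it carries the quotient topology
of the subspace topology on cycles. -/
abbrev Homology (n : ℕ) : Type _ :=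
  P.cycles f V n ⧸ (P.boundaries f V n).addSubgroupOf (P.cycles f V n)

variable [TopologicalSpace V] [IsTopologicalAddGroup V]

/-- The reduced cohomology: the quotient of `H^n(Γ, V)` by the closure of zero. -/
abbrev ReducedCohomology (n : ℕ) : Type _ :=
  P.Cohomology f V n ⧸ (⊥ : AddSubgroup (P.Cohomology f V n)).topologicalClosure

/-- The reduced homology: the quotient of `H_n(Γ, V)` by the closure of zero. -/
abbrev ReducedHomology (n : ℕ) : Type _ :=
  P.Homology f V n ⧸ (⊥ : AddSubgroup (P.Homology f V n)).topologicalClosure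

end Coefficients

/-- The coboundary map is precomposition with the boundary map of the complexified resolution,
written in the coordinates given by evaluation at the basis. -/
theorem cobdry_eval (V : Type*) [AddCommGroup V] [Module (MonoidAlgebra ℂ Γ) V] (n : ℕ)
    (F : (Fin (P.rank n) → MonoidAlgebra ℂ Γ) →ₗ[MonoidAlgebra ℂ Γ] V) :
    P.cobdry (RingHom.id _) V n (fun j => F (Pi.single j 1)) =
      fun i => F ((P.mat n).vecMulLinear (Pi.single i 1)) := by
  ext i
  have h : (P.mat n).vecMulLinear (Pi.single i 1) =
      ∑ j, P.mat n i j • (Pi.single j 1 : Fin (P.rank n) → MonoidAlgebra ℂ Γ) := by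
    ext1 k
    simp [Matrix.vecMulLinear, Finset.sum_apply, Pi.single_apply]
  rw [h, map_sum]
  simp [cobdry, matrixAct]

section Laplacian

/-! #### The Laplace operators over a `ℂΓ`-algebra `A`

The chain complex `A ⊗ P` consists of the free left `A`-modules `A^(rank n)` of row vectors, and
its `A`-linear maps are given by right multiplication by matrices. -/

variable {A : Type*} [Ring A] (φ : MonoidAlgebra ℂ Γ →+* A)

/-- The boundary map `d_{n+1}` of `A ⊗ P`, from degree `n + 1` to degree `n`. -/
noncomputable def chainD (n : ℕ) : (Fin (P.rank (n + 1)) → A) →ₗ[A] (Fin (P.rank n) → A) :=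
  ((P.mat n).map φ).vecMulLinear

/-- The formal adjoint `d_{n+1}^*`, from degree `n` to degree `n + 1`, given by the conjugate
transpose of the matrix of `d_{n+1}`. -/
noncomputable def chainDAdj (n : ℕ) : (Fin (P.rank n) → A) →ₗ[A] (Fin (P.rank (n + 1)) → A) :=
  ((P.mat n).conjTranspose.map φ).vecMulLinear

/-- The Laplace operator `Δ_n = d_n^* d_n + d_{n+1} d_{n+1}^*` on `A ⊗ P_n`, with `d_0 = 0`. -/
noncomputable def laplacian : (n : ℕ) → Module.End A (Fin (P.rank n) → A)
  | 0 => P.chainD φ 0 ∘ₗ P.chainDAdj φ 0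
  | n + 1 => P.chainDAdj φ n ∘ₗ P.chainD φ n + P.chainD φ (n + 1) ∘ₗ P.chainDAdj φ (n + 1)

end Laplacian

end FreeResolution

/-! Put `M = P.prevMat n` and `N = P.mat n`, mapped to `A`. Then `N * M = 0`, and on column vectors
`H^n` is `ker N / im M`, `H_n` is `ker M* / im N*`, and the Laplacian is `L = M M* + N* N`.
Exchanging `(M, N)` with `(N*, M*)` preserves `L`, so the homological conditions are the
cohomological ones for the swapped pair.

An inverse `G` of `L` commutes with `N* N` and acts as a Hodge homotopy over every coefficient
module: it makes cocycles exact (`ker_le_range_of_isUnit_laplacian`) and turns `im N` into the fixed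
points of a continuous idempotent, hence closed (`isClosed_range_of_isUnit_laplacian`).

There are two ways back. If `L` is not invertible, some state of `M_q(A)` kills it, and the GNS
construction yields a Hilbert representation of `A` with a nonzero harmonic vector, a cocycle
orthogonal to all coboundaries (`isUnit_laplacian_of_ker_le_closure`). For coefficients in `A`
itself, the open mapping theorem and Hilbert-module estimates show that `L` is bounded below on
`A^q`, which for a hermitian matrix forces invertibility (`isUnit_laplacian_of_isClosed_range`). -/

/-! ### Matrices acting on column vectors over a module. -/

section MatrixAct

variable {R : Type*} [Ring R] (V : Type*) [AddCommGroup V] [Module R V] {k l m : ℕ}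

theorem matrixAct_apply (M : Matrix (Fin k) (Fin l) R) (v : Fin l → V) (i : Fin k) :
    matrixAct V M v i = ∑ j, M i j • v j := rfl

theorem matrixAct_mul (M : Matrix (Fin k) (Fin l) R) (N : Matrix (Fin l) (Fin m) R)
    (v : Fin m → V) : matrixAct V (M * N) v = matrixAct V M (matrixAct V N v) := by
  ext i
  simp only [matrixAct_apply, Matrix.mul_apply, Finset.sum_smul, Finset.smul_sum, mul_smul]
  exact Finset.sum_comm

theorem matrixAct_add (M N : Matrix (Fin k) (Fin l) R) (v : Fin l → V) :
    matrixAct V (M + N) v = matrixAct V M v + matrixAct V N v := by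
  ext i
  simp [matrixAct_apply, add_smul, Finset.sum_add_distrib]

theorem matrixAct_one (v : Fin l → V) :
    matrixAct V (1 : Matrix (Fin l) (Fin l) R) v = v := by
  ext i
  simp [matrixAct_apply, Matrix.one_apply]

theorem matrixAct_zero (v : Fin l → V) :
    matrixAct V (0 : Matrix (Fin k) (Fin l) R) v = 0 := by
  ext i
  simp [matrixAct_apply]

theorem continuous_matrixAct [TopologicalSpace V] [IsTopologicalAddGroup V]
    [ContinuousConstSMul R V] (M : Matrix (Fin k) (Fin l) R) :
    Continuous (matrixAct V M) := by
  refine continuous_pi fun i => ?_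
  simp only [matrixAct_apply]
  fun_prop

theorem exists_mul_eq_of_forall_mem_range {p q r : ℕ} (M : Matrix (Fin q) (Fin r) R)
    (X : Matrix (Fin q) (Fin p) R)
    (h : ∀ j, (fun i => X i j) ∈ (matrixAct R M).range) : ∃ Y : Matrix (Fin r) (Fin p) R, M * Y = X := by
  choose y hy using h
  refine ⟨Matrix.of fun i j => y j i, ?_⟩
  ext i j
  exact congrFun (hy j) i

end MatrixAct

/-! ### Algebraic Hodge theory: consequences of an invertible Laplacian. -/

section HodgeTriple

variable {R : Type*} [Ring R] {p q r : ℕ}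
  {M : Matrix (Fin q) (Fin r) R} {M' : Matrix (Fin r) (Fin q) R}
  {N : Matrix (Fin p) (Fin q) R} {N' : Matrix (Fin q) (Fin p) R}

/-- The cross terms of `M M'` and `N' N` vanish, so `N' N` commutes with the Laplacian and therefore
with its inverse. No star structure is needed, so this also applies over rings of operators. -/
theorem commute_of_laplacian_inverse (h : N * M = 0) (h' : M' * N' = 0)
    {G : Matrix (Fin q) (Fin q) R} (hG₁ : (M * M' + N' * N) * G = 1)
    (hG₂ : G * (M * M' + N' * N) = 1) : N' * N * G = G * (N' * N) := by
  set L := M * M' + N' * N with hL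
  have hc : N' * N * L = L * (N' * N) := by
    have h1 : N' * N * (M * M') = 0 := by
      rw [Matrix.mul_assoc, ← Matrix.mul_assoc N, h, Matrix.zero_mul, Matrix.mul_zero]
    have h2 : M * M' * (N' * N) = 0 := by
      rw [Matrix.mul_assoc, ← Matrix.mul_assoc M', h', Matrix.zero_mul, Matrix.mul_zero]
    rw [hL, Matrix.mul_add, Matrix.add_mul, h1, h2]
  calc N' * N * G = G * L * (N' * N) * G := by rw [hG₂, one_mul]
    _ = G * (L * (N' * N)) * G := by rw [Matrix.mul_assoc G]
    _ = G * (N' * N) * (L * G) := by rw [← hc]; simp only [Matrix.mul_assoc]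
    _ = _ := by rw [hG₁, mul_one]

/-- If the Laplacian `M M' + N' N` of a complex is invertible, then the kernel of `N` is contained
in the range of `M`. -/
theorem ker_le_range_of_isUnit_laplacian (h : N * M = 0) (h' : M' * N' = 0)
    (hL : IsUnit (M * M' + N' * N)) (V : Type*) [AddCommGroup V] [Module R V] :
    (matrixAct V N).ker ≤ (matrixAct V M).range := by
  obtain ⟨G, hG₁, hG₂⟩ := isUnit_iff_exists.1 hL
  have hcG := commute_of_laplacian_inverse h h' hG₁ hG₂
  intro v hv
  rw [AddMonoidHom.mem_ker] at hv
  -- Expand `v = L G v = M M' G v + N' N G v`; the last term equals `G N' N v = 0`.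
  refine ⟨matrixAct V (M' * G) v, ?_⟩
  have h1 : matrixAct V (N' * N * G) v = 0 := by
    rw [hcG, ← Matrix.mul_assoc, matrixAct_mul, hv, map_zero]
  have h2 := congrArg (matrixAct V · v) hG₁
  simp only [matrixAct_one] at h2
  rwa [Matrix.add_mul, matrixAct_add, h1, add_zero, Matrix.mul_assoc, matrixAct_mul] at h2

/-- If the Laplacian `M M' + N' N` of a complex is invertible, then `N` has closed range. -/
theorem isClosed_range_of_isUnit_laplacian (h : N * M = 0) (h' : M' * N' = 0)
    (hL : IsUnit (M * M' + N' * N)) (V : Type*) [AddCommGroup V] [Module R V]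
    [TopologicalSpace V] [IsTopologicalAddGroup V] [ContinuousConstSMul R V] [T2Space V] :
    IsClosed ((matrixAct V N).range : Set (Fin p → V)) := by
  obtain ⟨G, hG₁, hG₂⟩ := isUnit_iff_exists.1 hL
  have hcG := commute_of_laplacian_inverse h h' hG₁ hG₂
  -- `G N'` is a generalized inverse of `N`, so `N G N'` is idempotent with the same image as `N`,
  -- and that image is its fixed-point set.
  have hN : N * (G * N') * N = N := by
    calc N * (G * N') * N = N * (G * (N' * N)) := by simp only [Matrix.mul_assoc]
      _ = N * ((M * M' + N' * N) * G) := by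
        rw [← hcG, Matrix.add_mul, Matrix.mul_add, Matrix.mul_assoc M, ← Matrix.mul_assoc N M, h,
          Matrix.zero_mul, zero_add]
      _ = N := by rw [hG₁, Matrix.mul_one]
  have hset : ((matrixAct V N).range : Set (Fin p → V)) =
      {y | matrixAct V (N * (G * N')) y = y} := by
    ext y
    constructor
    · rintro ⟨x, rfl⟩
      rw [Set.mem_ofPred_eq, ← matrixAct_mul, hN]
    · intro hy
      rw [Set.mem_ofPred_eq, matrixAct_mul] at hy
      exact ⟨_, hy⟩
  rw [hset]
  exact isClosed_eq (continuous_matrixAct V _) continuous_id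

end HodgeTriple

/-! ### States vanishing on a non-invertible self-adjoint element. -/

section States

open scoped ComplexOrder

/-- A self-adjoint element of a `C^*`-algebra which is not invertible is annihilated by a state. -/
theorem exists_state_apply_eq_zero {B : Type*} [CStarAlgebra B] [PartialOrder B]
    [StarOrderedRing B] {L : B} (hsa : IsSelfAdjoint L) (hL : ¬ IsUnit L) :
    ∃ f : B →ₚ[ℂ] ℂ, f 1 = 1 ∧ f L = 0 := by
  have hne : (1 : B) ≠ 0 := fun h => hL <| by
    have := subsingleton_of_zero_eq_one h.symm
    exact isUnit_of_subsingleton L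
  -- The multiples of `L` are built into the cone, so a functional that is nonnegative on `s` kills
  -- `L` as well as all skew-adjoint elements. M. Riesz extension starts from `a • 1 ↦ a`.
  let s : PointedCone ℝ B :=
    { carrier := {x | ∃ t : ℝ, 0 ≤ x + star x + t • L}
      add_mem' := by
        rintro x y ⟨t, ht⟩ ⟨t', ht'⟩
        refine ⟨t + t', (add_nonneg ht ht').trans_eq ?_⟩
        rw [star_add, add_smul]
        abel
      zero_mem' := ⟨0, by simp⟩
      smul_mem' := by
        rintro c x ⟨t, ht⟩
        refine ⟨c * t, (smul_nonneg c.2 ht).trans_eq ?_⟩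
        change (c : ℝ) • (x + star x + t • L) = (c : ℝ) • x + star ((c : ℝ) • x) + _
        rw [star_smul, star_trivial (c : ℝ), smul_add, smul_add, mul_smul] }
  have hs (x : B) : x ∈ s ↔ ∃ t : ℝ, 0 ≤ x + star x + t • L := Iff.rfl
  let f₀ : B →ₗ.[ℝ] ℝ := LinearPMap.mkSpanSingleton (1 : B) (1 : ℝ) hne
  have hf₀ (a : ℝ) (h : a • (1 : B) ∈ f₀.domain) : f₀ ⟨a • 1, h⟩ = a := by
    exact (LinearPMap.mkSpanSingleton'_apply (1 : B) (1 : ℝ) _ a h).trans (mul_one a)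
  obtain ⟨g, hg, hgs⟩ := riesz_extension s f₀ (by
    rintro ⟨x, hx⟩ hxs
    obtain ⟨a, rfl⟩ := Submodule.mem_span_singleton.1 hx
    rw [hf₀]
    by_contra! ha
    obtain ⟨t, ht⟩ := (hs _).1 hxs
    -- If `a • 1` lay in the cone with `a < 0`, then `t • L` would dominate a positive scalar and be
    -- invertible.
    have h1 : algebraMap ℝ B (-(2 * a)) ≤ t • L := by
      rw [← sub_nonneg]
      refine ht.trans_eq ?_
      simp only [star_smul, star_one, star_trivial, Algebra.algebraMap_eq_smul_one]
      module
    have h2 : IsUnit (t • L) := by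
      refine CStarAlgebra.isUnit_of_le _ h1 ?_
      rw [Algebra.algebraMap_eq_smul_one]
      have : 0 < -(2 * a) := by linarith
      exact isStrictlyPositive_one.smul this
    by_cases ht0 : t = 0
    · subst ht0
      rw [zero_smul] at h2
      exact hne (isUnit_zero_iff.1 h2).symm
    · exact hL ((isUnit_smul_iff (Units.mk0 t ht0) L).1 h2)) (by
    intro y
    refine ⟨⟨‖y + star y‖ • 1, Submodule.smul_mem _ _ (Submodule.mem_span_singleton_self _)⟩,
      (hs _).2 ⟨0, ?_⟩⟩
    have h1 : -(y + star y) ≤ algebraMap ℝ B ‖-(y + star y)‖ :=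
      IsSelfAdjoint.le_algebraMap_norm_self (by
        rw [isSelfAdjoint_iff]; simp [add_comm])
    have h2 : 0 ≤ algebraMap ℝ B ‖y + star y‖ := by
      exact algebraMap_nonneg B (norm_nonneg _)
    rw [norm_neg] at h1
    have h3 := add_nonneg (sub_nonneg.2 h1) h2
    refine h3.trans_eq ?_
    simp only [star_add, star_smul, star_one, star_trivial, Algebra.algebraMap_eq_smul_one,]
    module)
  -- Here both `x` and `-x` lie in the cone.
  have hskew (x : B) (t : ℝ) (hx : x + star x = t • L) : g x = 0 := by
    refine le_antisymm ?_ (hgs x ((hs x).2 ⟨-t, by simp [hx]⟩))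
    have := hgs (-x) ((hs _).2 ⟨t, by rw [star_neg, ← neg_add, hx]; simp⟩)
    rwa [map_neg, neg_nonneg] at this
  have him (x : B) (hx : IsSelfAdjoint x) : g (Complex.I • x) = 0 := by
    refine hskew _ 0 ?_
    rw [star_smul, hx.star_eq]
    simp
  have hre (x : B) (hx : IsSelfAdjoint x) :
      (Module.Dual.extendRCLike g : Module.Dual ℂ B) x = (g x : ℂ) := by
    rw [Module.Dual.extendRCLike_apply]
    change (g x : ℂ) - Complex.I * (g (Complex.I • x) : ℂ) = _
    rw [him x hx]
    simp
  refine ⟨PositiveLinearMap.mk₀ (Module.Dual.extendRCLike g) fun x hx => ?_, ?_, ?_⟩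
  · rw [hre x (.of_nonneg hx), Complex.zero_le_real]
    refine hgs x ((hs x).2 ⟨0, ?_⟩)
    rw [zero_smul, add_zero]
    exact add_nonneg hx (star_nonneg_iff.2 hx)
  · change (Module.Dual.extendRCLike g : Module.Dual ℂ B) 1 = 1
    rw [hre 1 (.one _)]
    have hmem : (1 : ℝ) • (1 : B) ∈ f₀.domain :=
      Submodule.smul_mem _ _ (Submodule.mem_span_singleton_self _)
    have h := (hg ⟨_, hmem⟩).trans (hf₀ 1 hmem)
    simp only [one_smul] at h
    simp [h]
  · change (Module.Dual.extendRCLike g : Module.Dual ℂ B) L = 0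
    rw [hre L hsa, hskew L 2]
    · simp
    · rw [hsa.star_eq]; module

end States

/-! ### From a state on `M_q(A)` to a vector in a representation of `A`. -/

section GNS

open scoped ComplexOrder InnerProductSpace

/-- The embedding of a `C^*`-algebra into its matrix algebra as scalar matrices. -/
noncomputable def CStarMatrix.scalarStarAlgHom (A : Type*) [CStarAlgebra A] (q : ℕ) :
    A →⋆ₐ[ℂ] CStarMatrix (Fin q) (Fin q) A where
  toFun a := CStarMatrix.ofMatrix (Matrix.diagonal fun _ => a)
  map_one' := Matrix.diagonal_one
  map_mul' _ _ := (Matrix.diagonal_mul_diagonal _ _).symm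
  map_zero' := Matrix.diagonal_zero
  map_add' _ _ := (Matrix.diagonal_add _ _).symm
  commutes' _ := rfl
  map_star' _ := (Matrix.diagonal_conjTranspose _).symm

/-- Restrict the GNS representation of `M_q(A)` to scalar matrices. With `ξ` the cyclic vector and
`e i j` the matrix units, each row `w i = (e i j ξ)_j` satisfies `∑ j, ⟪w i j, (L w i) j⟫ = ∑ j, f
(e j j * L) = f L = 0`. -/
theorem exists_representation_sum_inner_eq_zero {A : Type u} [CStarAlgebra A] {q : ℕ}
    {L : Matrix (Fin q) (Fin q) A} (hsa : L.IsHermitian) (hL : ¬ IsUnit L) :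
    ∃ (V : Type u) (_ : NormedAddCommGroup V) (_ : InnerProductSpace ℂ V) (_ : CompleteSpace V)
      (π : A →⋆ₐ[ℂ] (V →L[ℂ] V)) (v : Fin q → V), v ≠ 0 ∧
      ∑ j, ⟪v j, matrixAct V (L.map π) v j⟫_ℂ = 0 := by
  let _ : PartialOrder A := CStarAlgebra.spectralOrder A
  have : StarOrderedRing A := CStarAlgebra.spectralOrderedRing A
  let B := CStarMatrix (Fin q) (Fin q) A
  have hL' : ¬ IsUnit (CStarMatrix.ofMatrix L : B) := fun h =>
    hL (h.map (CStarMatrix.ofMatrixRingEquiv (n := Fin q) (A := A)).symm)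
  obtain ⟨f, hf1, hfL⟩ := exists_state_apply_eq_zero (L := (CStarMatrix.ofMatrix L : B)) hsa hL'
  let ρ := f.gnsStarAlgHom
  let ξ : f.GNS := (f.toPreGNS 1 : f.PreGNS)
  have hρ (b c : B) : ⟪ρ b ξ, ρ c ξ⟫_ℂ = f (star b * c) := by
    have h (b : B) : ρ b ξ = ((f.toPreGNS b : f.PreGNS) : f.GNS) := by
      change f.gnsNonUnitalStarAlgHom b _ = _
      rw [PositiveLinearMap.gnsNonUnitalStarAlgHom_apply_coe,
        PositiveLinearMap.leftMulMapPreGNS_apply]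
      simp
    rw [h, h, UniformSpace.Completion.inner_coe, PositiveLinearMap.preGNS_inner_def]
    rfl
  let e (i j : Fin q) : B := CStarMatrix.ofMatrix (Matrix.single i j 1)
  have he (i j k : Fin q) (b : B) : star (e i j) * (e i k * b) = e j k * b := by
    have h (b : Matrix (Fin q) (Fin q) A) : (Matrix.single i j (1 : A)).conjTranspose *
        (Matrix.single i k 1 * b) = Matrix.single j k 1 * b := by
      rw [Matrix.conjTranspose_single, star_one, ← Matrix.mul_assoc,
        Matrix.single_mul_single_same, one_mul]
    exact h b
  have hesum : ∑ j, e j j = 1 := by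
    have h : ∑ j, Matrix.single j j (1 : A) = (1 : Matrix (Fin q) (Fin q) A) := by
      ext i k
      rw [Matrix.sum_apply]
      simp [Matrix.single_apply, Matrix.one_apply, ite_and]
    exact h
  let w (i j : Fin q) : f.GNS := ρ (e i j) ξ
  let π := ρ.comp (CStarMatrix.scalarStarAlgHom A q)
  have hw (i k : Fin q) : matrixAct f.GNS (L.map π) (w i) k =
      ρ (e i k * CStarMatrix.ofMatrix L) ξ := by
    have h : e i k * CStarMatrix.ofMatrix L =
        ∑ j, CStarMatrix.scalarStarAlgHom A q (L k j) * e i j := by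
      have h : Matrix.single i k 1 * L =
          ∑ j, Matrix.diagonal (fun _ => L k j) * Matrix.single i j 1 := by
        ext a b
        rw [Matrix.sum_apply]
        simp [Matrix.mul_apply, Matrix.single_apply, Matrix.diagonal_apply, ite_and, eq_comm]
      exact h
    rw [h, map_sum, matrixAct_apply, sum_apply]
    simp only [map_mul]
    rfl
  have hsum (i : Fin q) : ∑ j, ⟪w i j, matrixAct f.GNS (L.map π) (w i) j⟫_ℂ = 0 := by
    simp only [hw, w, hρ, he]
    rw [← map_sum, ← Finset.sum_mul, hesum, one_mul, hfL]
  -- Otherwise `ξ = ∑ j, e j j ξ` would vanish, contrary to `f 1 = 1`.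
  have hex : ∃ i, w i ≠ 0 := by
    by_contra! h
    have h1 : ρ (∑ j, e j j) ξ = 0 := by
      rw [map_sum, sum_apply]
      exact Finset.sum_eq_zero fun i _ => congrFun (h i) i
    have h2 := hρ 1 (∑ j, e j j)
    rw [h1, hesum, inner_zero_right, star_one, one_mul, hf1] at h2
    exact zero_ne_one h2
  obtain ⟨i, hi⟩ := hex
  exact ⟨f.GNS, inferInstance, inferInstance, inferInstance, π, w i, hi, hsum i⟩

end GNS

/-! ### Harmonic vectors in Hilbert representations. -/

section Harmonic

open scoped InnerProductSpace

theorem sum_inner_matrixAct {A V : Type*} [CStarAlgebra A] [NormedAddCommGroup V]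
    [InnerProductSpace ℂ V] [CompleteSpace V] (π : A →⋆ₐ[ℂ] (V →L[ℂ] V)) {k l : ℕ}
    (T : Matrix (Fin k) (Fin l) A) (u : Fin k → V) (v : Fin l → V) :
    ∑ i, ⟪u i, matrixAct V (T.map π) v i⟫_ℂ =
      ∑ j, ⟪matrixAct V (T.conjTranspose.map π) u j, v j⟫_ℂ := by
  simp only [matrixAct_apply, inner_sum, sum_inner]
  rw [Finset.sum_comm]
  refine Finset.sum_congr rfl fun j _ => Finset.sum_congr rfl fun i _ => ?_
  simp only [Matrix.map_apply, Matrix.conjTranspose_apply, map_star]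
  exact (ContinuousLinearMap.adjoint_inner_left (π (T i j)) (v j) (u i)).symm

theorem map_laplacian {A R F : Type*} [Ring A] [Ring R] [FunLike F A R] [RingHomClass F A R]
    (π : F) {p q r : ℕ} (M : Matrix (Fin q) (Fin r) A) (M' : Matrix (Fin r) (Fin q) A)
    (N : Matrix (Fin p) (Fin q) A) (N' : Matrix (Fin q) (Fin p) A) :
    (M * M' + N' * N).map π = M.map π * M'.map π + N'.map π * N.map π := by
  rw [Matrix.map_add _ (map_add π), Matrix.map_mul, Matrix.map_mul]

/-- If in every Hilbert `*`-representation the kernel of `N` is contained in the closure of the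
range of `M`, then the Laplacian `M M^* + N^* N` is invertible. -/
theorem isUnit_laplacian_of_ker_le_closure {A : Type u} [CStarAlgebra A] {p q r : ℕ}
    {M : Matrix (Fin q) (Fin r) A} {N : Matrix (Fin p) (Fin q) A}
    (h : ∀ (V : Type u) [NormedAddCommGroup V] [InnerProductSpace ℂ V] [CompleteSpace V]
      (π : A →⋆ₐ[ℂ] (V →L[ℂ] V)), ((matrixAct V (N.map π)).ker : Set (Fin q → V)) ⊆
        closure (matrixAct V (M.map π)).range) :
    IsUnit (M * M.conjTranspose + N.conjTranspose * N) := by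
  by_contra hL
  have hsa : (M * M.conjTranspose + N.conjTranspose * N).IsHermitian :=
    (Matrix.isHermitian_mul_conjTranspose_self M).add
      (Matrix.isHermitian_conjTranspose_mul_self N)
  obtain ⟨V, _, _, _, π, v, hv, hLv⟩ := exists_representation_sum_inner_eq_zero hsa hL
  rw [map_laplacian] at hLv
  simp only [matrixAct_add, matrixAct_mul, Pi.add_apply, inner_add_right,
    Finset.sum_add_distrib] at hLv
  rw [sum_inner_matrixAct π M, sum_inner_matrixAct π N.conjTranspose,
    Matrix.conjTranspose_conjTranspose] at hLv
  have hpos {k : ℕ} (x : Fin k → V) :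
      ∑ i, ⟪x i, x i⟫_ℂ = ((∑ i, ‖x i‖ ^ 2 : ℝ) : ℂ) := by
    push_cast
    exact Finset.sum_congr rfl fun i _ => inner_self_eq_norm_sq_to_K (x i)
  have hzero {k : ℕ} {x : Fin k → V} (hx : ∑ i, ‖x i‖ ^ 2 = 0) : x = 0 := by
    ext1 i
    have := (Finset.sum_eq_zero_iff_of_nonneg fun i _ => sq_nonneg ‖x i‖).1 hx i
      (Finset.mem_univ i)
    simpa using this
  rw [hpos, hpos, ← Complex.ofReal_add, Complex.ofReal_eq_zero,
    add_eq_zero_iff_of_nonneg (by positivity) (by positivity)] at hLv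
  -- `⟪v, L v⟫ = ‖M* v‖² + ‖N v‖²` vanishes, so `v` is a cocycle orthogonal to the range of `M`.
  -- Lying in the closure of that range, it is orthogonal to itself.
  have hM := hzero hLv.1
  have hN := hzero hLv.2
  have hmem := h V π hN
  have hclosed : IsClosed {w : Fin q → V | ∑ i, ⟪v i, w i⟫_ℂ = 0} :=
    isClosed_eq (by fun_prop) continuous_const
  have hsub : ((matrixAct V (M.map π)).range : Set (Fin q → V)) ⊆
      {w : Fin q → V | ∑ i, ⟪v i, w i⟫_ℂ = 0} := by
    rintro _ ⟨y, rfl⟩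
    change ∑ i, ⟪v i, matrixAct V (M.map π) y i⟫_ℂ = 0
    rw [sum_inner_matrixAct, hM]
    simp
  have hvv : ∑ i, ⟪v i, v i⟫_ℂ = 0 := closure_minimal hsub hclosed hmem
  rw [hpos, Complex.ofReal_eq_zero] at hvv
  exact hv (hzero hvv)

end Harmonic

/-! ### Coefficients in `A`: closed range and invertibility. -/

section ClosedRange

variable {A : Type*} [CStarAlgebra A] {p q r : ℕ}

/-- The action of a matrix on column vectors, as a bounded operator. -/
noncomputable def matrixActCLM (T : Matrix (Fin p) (Fin q) A) :
    (Fin q → A) →L[ℂ] (Fin p → A) where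
  toFun := matrixAct A T
  map_add' := map_add _
  map_smul' c v := by
    ext i
    simp [matrixAct_apply, Finset.smul_sum]
  cont := continuous_matrixAct A T

theorem matrixActCLM_apply (T : Matrix (Fin p) (Fin q) A) (v : Fin q → A) :
    matrixActCLM T v = matrixAct A T v := rfl

/-- Preimages under a bounded operator with closed range may be chosen with controlled norm. -/
theorem exists_preimage_norm_le_of_isClosed_range {E F : Type*} [NormedAddCommGroup E]
    [NormedSpace ℂ E] [CompleteSpace E] [NormedAddCommGroup F] [NormedSpace ℂ F] [CompleteSpace F]
    (f : E →L[ℂ] F) (hf : IsClosed (Set.range f)) :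
    ∃ C > 0, ∀ x, ∃ y, f y = f x ∧ ‖y‖ ≤ C * ‖f x‖ := by
  have : CompleteSpace (LinearMap.range f.toLinearMap) := by
    refine IsClosed.completeSpace_coe (hs := ?_)
    exact hf
  obtain ⟨C, hC, h⟩ := f.rangeRestrict.exists_preimage_norm_le (by
    rintro ⟨_, x, rfl⟩
    exact ⟨x, rfl⟩)
  refine ⟨C, hC, fun x => ?_⟩
  obtain ⟨y, hy, hle⟩ := h (f.rangeRestrict x)
  exact ⟨y, congrArg Subtype.val hy, hle⟩

theorem sum_star_mul_matrixAct (T : Matrix (Fin p) (Fin q) A) (u : Fin p → A) (v : Fin q → A) :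
    ∑ i, star (u i) * matrixAct A T v i =
      ∑ j, star (matrixAct A T.conjTranspose u j) * v j := by
  simp only [matrixAct_apply, Finset.mul_sum, star_sum, Finset.sum_mul, smul_eq_mul, star_mul,
    Matrix.conjTranspose_apply, star_star, mul_assoc]
  exact Finset.sum_comm

theorem norm_sum_star_mul_le (u v : Fin q → A) :
    ‖∑ i, star (u i) * v i‖ ≤ q * (‖u‖ * ‖v‖) := by
  refine (norm_sum_le _ _).trans ?_
  have : ∀ i ∈ Finset.univ, ‖star (u i) * v i‖ ≤ ‖u‖ * ‖v‖ := fun i _ => by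
    refine (norm_mul_le _ _).trans ?_
    rw [norm_star]
    gcongr <;> exact norm_le_pi_norm _ i
  simpa using Finset.sum_le_card_nsmul _ _ _ this

/-- Each `star (u i) * u i` is dominated by the whole positive sum, and the norm is monotone on
positive elements. -/
theorem norm_sq_le_norm_sum_add [PartialOrder A] [StarOrderedRing A] (u : Fin q → A) {b : A}
    (hb : 0 ≤ b) : ‖u‖ ^ 2 ≤ ‖∑ i, star (u i) * u i + b‖ := by
  have h (i) : ‖u i‖ ≤ √‖∑ i, star (u i) * u i + b‖ := by
    refine Real.le_sqrt_of_sq_le ?_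
    rw [sq, ← CStarRing.norm_star_mul_self]
    refine CStarAlgebra.norm_le_norm_of_nonneg_of_le (star_mul_self_nonneg _) ?_
    refine (Finset.single_le_sum (f := fun i => star (u i) * u i)
      (fun i _ => star_mul_self_nonneg _) (Finset.mem_univ i)).trans ?_
    exact le_add_of_nonneg_right hb
  have := (pi_norm_le_iff_of_nonneg (Real.sqrt_nonneg _)).2 h
  rwa [Real.le_sqrt (norm_nonneg _) (norm_nonneg _)] at this

/-- The `A`-valued product `⟨h, L h⟩` is `⟨M* h, M* h⟩ + ⟨N h, N h⟩`. Both summands are positive in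
`A`, so each is controlled by the norm of the total. -/
theorem matrixAct_laplacian_bounds (M : Matrix (Fin q) (Fin r) A) (N : Matrix (Fin p) (Fin q) A)
    (h : Fin q → A) :
    ‖matrixAct A M.conjTranspose h‖ ^ 2 ≤
      q * (‖h‖ * ‖matrixAct A (M * M.conjTranspose + N.conjTranspose * N) h‖) ∧
    ‖matrixAct A N h‖ ^ 2 ≤
      q * (‖h‖ * ‖matrixAct A (M * M.conjTranspose + N.conjTranspose * N) h‖) := by
  let _ : PartialOrder A := CStarAlgebra.spectralOrder A
  have : StarOrderedRing A := CStarAlgebra.spectralOrderedRing A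
  have hsum := norm_sum_star_mul_le h
    (matrixAct A (M * M.conjTranspose + N.conjTranspose * N) h)
  simp only [matrixAct_add, matrixAct_mul, Pi.add_apply, mul_add, Finset.sum_add_distrib] at hsum
  rw [sum_star_mul_matrixAct M, sum_star_mul_matrixAct N.conjTranspose, Matrix.conjTranspose_conjTranspose] at hsum
  simp only [matrixAct_add, matrixAct_mul]
  refine ⟨le_trans ?_ hsum, le_trans ?_ hsum⟩
  · exact norm_sq_le_norm_sum_add _ (Finset.sum_nonneg fun i _ => star_mul_self_nonneg _)
  · rw [add_comm]
    exact norm_sq_le_norm_sum_add _ (Finset.sum_nonneg fun i _ => star_mul_self_nonneg _)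

/-- If `N` has closed range and its kernel is the range of `M`, then the Laplacian is bounded
below. -/
theorem exists_norm_le_laplacian {M : Matrix (Fin q) (Fin r) A} {N : Matrix (Fin p) (Fin q) A}
    (hNM : N * M = 0) (hker : (matrixAct A N).ker ≤ (matrixAct A M).range)
    (hclosed : IsClosed ((matrixAct A N).range : Set (Fin p → A))) :
    ∃ K > 0, ∀ h : Fin q → A,
      ‖h‖ ≤ K * ‖matrixAct A (M * M.conjTranspose + N.conjTranspose * N) h‖ := by
  let _ : PartialOrder A := CStarAlgebra.spectralOrder A
  have : StarOrderedRing A := CStarAlgebra.spectralOrderedRing A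
  have hrangeM : Set.range (matrixActCLM M) = {v | matrixAct A N v = 0} := by
    ext v
    refine ⟨?_, fun hv => hker hv⟩
    rintro ⟨y, rfl⟩
    change matrixAct A N (matrixAct A M y) = 0
    rw [← matrixAct_mul, hNM, matrixAct_zero]
  obtain ⟨C, hC, hN⟩ := exists_preimage_norm_le_of_isClosed_range (matrixActCLM N) hclosed
  obtain ⟨D, hD, hM⟩ := exists_preimage_norm_le_of_isClosed_range (matrixActCLM M) (by
    rw [hrangeM]
    exact isClosed_eq (continuous_matrixAct A N) continuous_const)
  set S := ‖matrixActCLM N‖ with hS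
  have hS0 : 0 ≤ S := norm_nonneg _
  set κ : ℝ := q * C + r * (D * (1 + C * S)) with hκ
  have hκ0 : 0 ≤ κ := by positivity
  -- The estimate works with `κ ^ 2 * q`; adding `1` only secures strict positivity.
  refine ⟨κ ^ 2 * q + 1, by positivity, fun h => ?_⟩
  set L := M * M.conjTranspose + N.conjTranspose * N with hL
  obtain ⟨hb₁, hb₂⟩ := matrixAct_laplacian_bounds M N h
  rw [← hL] at hb₁ hb₂
  set z := ‖matrixAct A L h‖ with hz
  set s := √(q * (‖h‖ * z)) with hs
  have hs₁ : ‖matrixAct A M.conjTranspose h‖ ≤ s := Real.le_sqrt_of_sq_le hb₁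
  have hs₂ : ‖matrixAct A N h‖ ≤ s := Real.le_sqrt_of_sq_le hb₂
  have hs0 : 0 ≤ s := Real.sqrt_nonneg _
  -- Split `h = x + M y` with `x` controlled by `N h`. Pairing with `h` gives `⟨h, h⟩ = ⟨h, x⟩ + ⟨M*
  -- h, y⟩`, where each term contains a factor bounded by `s`, of order the square root of `‖h‖ ‖L
  -- h‖`.
  obtain ⟨x, hx, hxn⟩ := hN h
  rw [matrixActCLM_apply, matrixActCLM_apply] at hx
  obtain ⟨y', hy'⟩ : h - x ∈ (matrixAct A M).range := hker (by
    rw [AddMonoidHom.mem_ker, map_sub, hx, sub_self])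
  obtain ⟨y, hy, hyn⟩ := hM y'
  rw [matrixActCLM_apply, matrixActCLM_apply, hy'] at hy
  rw [matrixActCLM_apply, hy'] at hyn
  have hxs : ‖x‖ ≤ C * s := hxn.trans (by gcongr; exact hs₂)
  have hxh : ‖x‖ ≤ C * S * ‖h‖ := by
    refine hxn.trans ?_
    rw [mul_assoc]
    gcongr
    exact (matrixActCLM N).le_opNorm h
  have hyh : ‖y‖ ≤ D * (1 + C * S) * ‖h‖ := by
    refine hyn.trans ?_
    rw [mul_assoc]
    gcongr
    linarith [norm_sub_le h x]
  have hdecomp : h = x + matrixAct A M y := by rw [hy]; abel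
  have hsq : ‖h‖ ^ 2 ≤ κ * ‖h‖ * s := by
    have h1 := norm_sq_le_norm_sum_add h le_rfl
    rw [add_zero] at h1
    have h2 : ∑ i, star (h i) * h i =
        ∑ i, star (h i) * x i + ∑ j, star (matrixAct A M.conjTranspose h j) * y j := by
      rw [← sum_star_mul_matrixAct, ← Finset.sum_add_distrib]
      refine Finset.sum_congr rfl fun i _ => ?_
      rw [← mul_add]
      exact congrArg (star (h i) * ·) (congrFun hdecomp i)
    rw [h2] at h1
    calc ‖h‖ ^ 2 ≤ _ := h1
      _ ≤ _ := norm_add_le _ _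
      _ ≤ q * (‖h‖ * ‖x‖) + r * (‖matrixAct A M.conjTranspose h‖ * ‖y‖) :=
        add_le_add (norm_sum_star_mul_le _ _) (norm_sum_star_mul_le _ _)
      _ ≤ q * (‖h‖ * (C * s)) + r * (s * (D * (1 + C * S) * ‖h‖)) := by gcongr
      _ = κ * ‖h‖ * s := by rw [hκ]; ring
  rcases (norm_nonneg h).eq_or_lt with h0 | h0
  · rw [← h0]; positivity
  have hlin : ‖h‖ ≤ κ * s := by
    refine le_of_mul_le_mul_left ?_ h0
    linarith [hsq]
  have hs2 : s ^ 2 = q * (‖h‖ * z) := Real.sq_sqrt (by positivity)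
  have hsq2 : ‖h‖ * ‖h‖ ≤ ‖h‖ * (κ ^ 2 * q * z) := by
    calc ‖h‖ * ‖h‖ ≤ (κ * s) * (κ * s) := by gcongr
      _ = κ ^ 2 * s ^ 2 := by ring
      _ = _ := by rw [hs2]; ring
  have := le_of_mul_le_mul_left hsq2 h0
  have hz0 : 0 ≤ z := norm_nonneg _
  linarith

/-- A hermitian matrix over a `C^*`-algebra which is bounded below on column vectors is
invertible. -/
theorem isUnit_of_isHermitian_of_norm_le {L : Matrix (Fin q) (Fin q) A} (hsa : L.IsHermitian)
    {K : ℝ} (hK : 0 < K) (hbound : ∀ h : Fin q → A, ‖h‖ ≤ K * ‖matrixAct A L h‖) :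
    IsUnit L := by
  let _ : PartialOrder A := CStarAlgebra.spectralOrder A
  have : StarOrderedRing A := CStarAlgebra.spectralOrderedRing A
  -- The imaginary point `c = t i` lies off the real spectrum of `L`. The lower bound on `L` bounds
  -- the resolvent `G = (c - L)⁻¹` by `2 * K` on columns, so `c G` has norm at most `1 / 2` for this
  -- `t`.
  set t : ℝ := (4 * K)⁻¹ with ht
  have ht0 : 0 < t := by positivity
  set c : ℂ := t * Complex.I with hc
  have hcn : ‖c‖ = t := by simp [hc, abs_of_pos ht0]
  have hunit : IsUnit (algebraMap ℂ (Matrix (Fin q) (Fin q) A) c - L) := by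
    have hsa' : IsSelfAdjoint (CStarMatrix.ofMatrix L : CStarMatrix (Fin q) (Fin q) A) := hsa
    have h1 : c ∉ spectrum ℂ (CStarMatrix.ofMatrix L : CStarMatrix (Fin q) (Fin q) A) :=
      fun h => by
        have := hsa'.im_eq_zero_of_mem_spectrum h
        simp [hc] at this
        exact ht0.ne' this
    have h2 := spectrum.notMem_iff.1 h1
    exact h2.map (CStarMatrix.ofMatrixRingEquiv (n := Fin q) (A := A)).symm
  obtain ⟨G, hG₁, hG₂⟩ := isUnit_iff_exists.1 hunit
  have hact (v : Fin q → A) :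
      matrixAct A (algebraMap ℂ (Matrix (Fin q) (Fin q) A) c) v = c • v := by
    ext i
    rw [Algebra.algebraMap_eq_smul_one]
    simp [matrixAct_apply, Matrix.one_apply]
  have hG (v : Fin q → A) : ‖matrixAct A G v‖ ≤ 2 * K * ‖v‖ := by
    set w := matrixAct A G v with hw
    have h1 : c • w - matrixAct A L w = v := by
      have := congrArg (matrixAct A · v) hG₁
      simp only [matrixAct_mul, matrixAct_one] at this
      rw [← hw, sub_eq_add_neg, matrixAct_add, hact] at this
      rw [← this, sub_eq_add_neg]
      congr 1
      ext i
      simp [matrixAct_apply]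
    have h2 : ‖matrixAct A L w‖ ≤ t * ‖w‖ + ‖v‖ := by
      have : matrixAct A L w = c • w - v := by rw [← h1]; abel
      rw [this, ← hcn, ← norm_smul]
      exact norm_sub_le _ _
    have h3 := (hbound w).trans (mul_le_mul_of_nonneg_left h2 hK.le)
    have h4 : K * (t * ‖w‖ + ‖v‖) = ‖w‖ / 4 + K * ‖v‖ := by rw [ht]; field_simp
    rw [h4] at h3
    have := norm_nonneg w
    nlinarith
  -- `L = (c - L) * (c * G - 1)`, and `c * G` has norm less than one on column vectors
  have hcG : ‖c • matrixActCLM G‖ < 1 := by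
    have h1 : ‖matrixActCLM G‖ ≤ 2 * K :=
      ContinuousLinearMap.opNorm_le_bound _ (by positivity) hG
    rw [norm_smul, hcn]
    calc t * ‖matrixActCLM G‖ ≤ t * (2 * K) := by gcongr
      _ = 1 / 2 := by rw [ht]; field_simp; norm_num
      _ < 1 := by norm_num
  have hU := (Units.oneSub _ hcG).isUnit
  rw [Units.val_oneSub] at hU
  obtain ⟨T, hT₁, hT₂⟩ := isUnit_iff_exists.1 hU
  have hsurj (v : Fin q → A) : v ∈ (matrixAct A L).range := by
    -- `L (-G) = (c - L) G - c G = 1 - c G`, whose inverse is `T`.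
    refine ⟨-matrixAct A G (T v), ?_⟩
    have h1 : T v - c • matrixAct A G (T v) = v := congrArg (· v) hT₁
    have h2 := congrArg (matrixAct A · (T v)) hG₁
    simp only [matrixAct_mul, matrixAct_one] at h2
    have h3 : matrixAct A (algebraMap ℂ (Matrix (Fin q) (Fin q) A) c - L) (matrixAct A G (T v)) =
        c • matrixAct A G (T v) - matrixAct A L (matrixAct A G (T v)) := by
      rw [eq_sub_iff_add_eq, ← matrixAct_add, sub_add_cancel, hact]
    rw [h3] at h2
    calc matrixAct A L (-matrixAct A G (T v))
        = (c • matrixAct A G (T v) - matrixAct A L (matrixAct A G (T v))) -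
            c • matrixAct A G (T v) := by rw [map_neg]; abel
      _ = v := by rw [h2, h1]
  -- `T` is only a bounded operator; preimages of the standard columns assemble into a matrix right
  -- inverse, whose adjoint is a left inverse.
  obtain ⟨X, hX⟩ := exists_mul_eq_of_forall_mem_range L (1 : Matrix (Fin q) (Fin q) A)
    fun j => hsurj _
  have hX' : X.conjTranspose * L = 1 := by
    have := congrArg Matrix.conjTranspose hX
    rwa [Matrix.conjTranspose_mul, hsa.eq, Matrix.conjTranspose_one] at this
  exact isUnit_iff_exists.2 ⟨X, hX, by rwa [left_inv_eq_right_inv hX' hX] at hX'⟩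

theorem isUnit_laplacian_of_isClosed_range {M : Matrix (Fin q) (Fin r) A}
    {N : Matrix (Fin p) (Fin q) A} (hNM : N * M = 0)
    (hker : (matrixAct A N).ker ≤ (matrixAct A M).range)
    (hclosed : IsClosed ((matrixAct A N).range : Set (Fin p → A))) :
    IsUnit (M * M.conjTranspose + N.conjTranspose * N) := by
  obtain ⟨K, hK, h⟩ := exists_norm_le_laplacian hNM hker hclosed
  exact isUnit_of_isHermitian_of_norm_le ((Matrix.isHermitian_mul_conjTranspose_self M).add
    (Matrix.isHermitian_conjTranspose_mul_self N)) hK h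

end ClosedRange

/-! ### Vanishing and Hausdorff criteria for subquotients. -/

section TopologicalQuotient

variable {E : Type*} [AddCommGroup E] {Z B : AddSubgroup E}

theorem subsingleton_quotient_addSubgroupOf_iff :
    Subsingleton (Z ⧸ B.addSubgroupOf Z) ↔ Z ≤ B := by
  rw [QuotientAddGroup.subsingleton_iff, AddSubgroup.addSubgroupOf_eq_top]

variable [TopologicalSpace E] [IsTopologicalAddGroup E]

/-- The quotient map is open, so the closure of zero pulls back to the closure of `B` inside `Z`. -/
theorem subsingleton_reduced_quotient_iff (hBZ : B ≤ Z) :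
    Subsingleton ((Z ⧸ B.addSubgroupOf Z) ⧸
      (⊥ : AddSubgroup (Z ⧸ B.addSubgroupOf Z)).topologicalClosure) ↔
      (Z : Set E) ⊆ closure (B : Set E) := by
  have hpre : (QuotientAddGroup.mk : Z → Z ⧸ B.addSubgroupOf Z) ⁻¹'
      closure {(0 : Z ⧸ B.addSubgroupOf Z)} = closure (Subtype.val ⁻¹' (B : Set E)) := by
    rw [QuotientAddGroup.isOpenMap_coe.preimage_closure_eq_closure_preimage
      QuotientAddGroup.continuous_mk]
    congr 1
    ext x
    rw [Set.mem_preimage, Set.mem_singleton_iff, QuotientAddGroup.eq_zero_iff]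
    rfl
  rw [QuotientAddGroup.subsingleton_iff, eq_top_iff]
  constructor
  · intro h z hz
    have h1 : (⟨z, hz⟩ : Z) ∈ (QuotientAddGroup.mk : Z → Z ⧸ B.addSubgroupOf Z) ⁻¹'
      closure {(0 : Z ⧸ B.addSubgroupOf Z)} := h (AddSubgroup.mem_top _)
    rw [hpre, closure_subtype] at h1
    exact closure_mono (Set.image_preimage_subset _ _) h1
  · intro h x _
    obtain ⟨z, rfl⟩ := QuotientAddGroup.mk_surjective x
    change z ∈ (QuotientAddGroup.mk : Z → Z ⧸ B.addSubgroupOf Z) ⁻¹'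
      closure {(0 : Z ⧸ B.addSubgroupOf Z)}
    have himage : Subtype.val '' (Subtype.val ⁻¹' (B : Set E) : Set Z) = (B : Set E) :=
      Subtype.image_preimage_coe _ _ |>.trans (Set.inter_eq_right.2 hBZ)
    rw [hpre, closure_subtype, himage]
    exact h z.2

theorem t2Space_quotient_addSubgroupOf_iff (hBZ : B ≤ Z) (hZ : IsClosed (Z : Set E)) :
    T2Space (Z ⧸ B.addSubgroupOf Z) ↔ IsClosed (B : Set E) := by
  have himage : Subtype.val '' (B.addSubgroupOf Z : Set Z) = (B : Set E) := by
    ext x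
    constructor
    · rintro ⟨y, hy, rfl⟩
      exact hy
    · exact fun hx => ⟨⟨x, hBZ hx⟩, hx, rfl⟩
  have h : IsClosed (B : Set E) ↔ IsClosed (B.addSubgroupOf Z : Set Z) := by
    rw [hZ.isClosedEmbedding_subtypeVal.isClosed_iff_image_isClosed]
    exact iff_of_eq (congrArg IsClosed himage.symm)
  rw [h]
  constructor
  · intro _
    have := (isClosed_singleton (x := (0 : Z ⧸ B.addSubgroupOf Z))).preimage
      QuotientAddGroup.continuous_mk
    convert this using 1
    ext x
    rw [Set.mem_preimage, Set.mem_singleton_iff, QuotientAddGroup.eq_zero_iff]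
    rfl
  · intro h
    have : IsClosed (B.addSubgroupOf Z : Set Z) := h
    infer_instance

end TopologicalQuotient

/-! ### The equivalences for a pair of composable matrices. -/

section LaplacianTFAE

variable {A : Type u} [CStarAlgebra A] {p q r : ℕ}

theorem isUnit_laplacian_tfae {M : Matrix (Fin q) (Fin r) A} {N : Matrix (Fin p) (Fin q) A}
    (hNM : N * M = 0) :
    List.TFAE [
      IsUnit (M * M.conjTranspose + N.conjTranspose * N),
      ∀ (V : Type u) [NormedAddCommGroup V] [InnerProductSpace ℂ V] [CompleteSpace V]
        (π : A →⋆ₐ[ℂ] (V →L[ℂ] V)), ((matrixAct V (N.map π)).ker : Set (Fin q → V)) ⊆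
          closure (matrixAct V (M.map π)).range,
      ∀ (V : Type u) [NormedAddCommGroup V] [InnerProductSpace ℂ V] [CompleteSpace V]
        (π : A →⋆ₐ[ℂ] (V →L[ℂ] V)),
        (matrixAct V (N.map π)).ker ≤ (matrixAct V (M.map π)).range,
      ∀ (V : Type u) [NormedAddCommGroup V] [InnerProductSpace ℂ V] [CompleteSpace V]
        (π : A →⋆ₐ[ℂ] (V →L[ℂ] V)),
        (matrixAct V (N.map π)).ker ≤ (matrixAct V (M.map π)).range ∧
          IsClosed ((matrixAct V (N.map π)).range : Set (Fin p → V)),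
      ∀ (V : Type u) [AddCommGroup V] [Module A V],
        (matrixAct V N).ker ≤ (matrixAct V M).range,
      (matrixAct A N).ker ≤ (matrixAct A M).range ∧
        IsClosed ((matrixAct A N).range : Set (Fin p → A))] := by
  have hMN : M.conjTranspose * N.conjTranspose = 0 := by
    rw [← Matrix.conjTranspose_mul, hNM, Matrix.conjTranspose_zero]
  tfae_have 1 → 5 := fun h V _ _ => ker_le_range_of_isUnit_laplacian hNM hMN h V
  tfae_have 5 → 3 := fun h V _ _ _ π =>
    letI : Module A V := Module.compHom V (π : A →+* (V →L[ℂ] V))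
    h V
  tfae_have 3 → 2 := fun h V _ _ _ π =>
    Set.Subset.trans (h V π) subset_closure
  tfae_have 2 → 1 := isUnit_laplacian_of_ker_le_closure
  tfae_have 4 → 3 := fun h V _ _ _ π => (h V π).1
  -- Push the matrices through `π` and apply Hodge theory over the ring of bounded operators on `V`.
  tfae_have 1 → 4 := fun h V _ _ _ π => by
    have hL := h.map (π : A →+* (V →L[ℂ] V)).mapMatrix
    have h1 : N.map π * M.map π = 0 := by
      rw [← Matrix.map_mul, hNM, Matrix.map_zero _ (map_zero π)]
    have h2 : M.conjTranspose.map π * N.conjTranspose.map π = 0 := by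
      rw [← Matrix.map_mul, hMN, Matrix.map_zero _ (map_zero π)]
    have h3 := map_laplacian π M M.conjTranspose N N.conjTranspose
    rw [RingHom.mapMatrix_apply] at hL
    replace hL := h3 ▸ hL
    exact ⟨ker_le_range_of_isUnit_laplacian h1 h2 hL V,
      isClosed_range_of_isUnit_laplacian h1 h2 hL V⟩
  tfae_have 1 → 6 := fun h => ⟨ker_le_range_of_isUnit_laplacian hNM hMN h A,
    isClosed_range_of_isUnit_laplacian hNM hMN h A⟩
  tfae_have 6 → 1 := fun h => isUnit_laplacian_of_isClosed_range hNM h.1 h.2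
  tfae_finish

end LaplacianTFAE

/-! ### The involution laws on the group algebra. -/

theorem groupAlgebra_star_add {Γ : Type*} [Group Γ] (x y : MonoidAlgebra ℂ Γ) :
    star (x + y) = star x + star y := by
  change (x + y).coeff.sum _ = x.coeff.sum _ + y.coeff.sum _
  rw [MonoidAlgebra.coeff_add]
  exact Finsupp.sum_add_index' (by simp) (by simp)

theorem groupAlgebra_star_zero (Γ : Type*) [Group Γ] : star (0 : MonoidAlgebra ℂ Γ) = 0 := by
  simpa using groupAlgebra_star_add (0 : MonoidAlgebra ℂ Γ) 0

theorem groupAlgebra_star_mul {Γ : Type*} [Group Γ] (x y : MonoidAlgebra ℂ Γ) :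
    star (x * y) = star y * star x := by
  induction x using MonoidAlgebra.induction_linear with
  | zero => simp [groupAlgebra_star_zero]
  | add x x' hx hx' => rw [add_mul, groupAlgebra_star_add, hx, hx', groupAlgebra_star_add, mul_add]
  | single g a =>
    induction y using MonoidAlgebra.induction_linear with
    | zero => simp [groupAlgebra_star_zero]
    | add y y' hy hy' =>
      rw [mul_add, groupAlgebra_star_add, hy, hy', groupAlgebra_star_add, add_mul]
    | single h b =>
      rw [MonoidAlgebra.single_mul_single, groupAlgebra_star_single, groupAlgebra_star_single,
        groupAlgebra_star_single, MonoidAlgebra.single_mul_single, mul_inv_rev, map_mul,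
        mul_comm (starRingEnd ℂ b)]

/-! ### Matrices of the complexified resolution. -/

namespace FreeResolution

variable {Γ : Type*} [Group Γ] (P : FreeResolution Γ)

/-- The rank of the module in the preceding degree; it is zero in degree `-1`. -/
def prevRank : ℕ → ℕ
  | 0 => 0
  | n + 1 => P.rank n

/-- The matrix of the boundary map `d_n`, from degree `n` to degree `n - 1`. -/
noncomputable def prevMat :
    (n : ℕ) → Matrix (Fin (P.rank n)) (Fin (P.prevRank n)) (MonoidAlgebra ℂ Γ)
  | 0 => 0
  | n + 1 => P.mat n

theorem mat_mul_mat (n : ℕ) : P.mat (n + 1) * P.mat n = 0 := by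
  ext1 i k
  have h : P.d n (P.d (n + 1) (Pi.single i 1)) = 0 := (P.exact_succ n).apply_apply_eq_zero _
  have h1 := congrFun h k
  rw [LinearMap.pi_apply_eq_sum_univ] at h1
  have h2 := congrArg (MonoidAlgebra.mapRingHom Γ (algebraMap ℚ ℂ)) h1
  simp only [Finset.sum_apply, Pi.smul_apply, smul_eq_mul, map_sum, map_mul, Pi.zero_apply,
    map_zero] at h2
  rw [Matrix.mul_apply, Matrix.zero_apply, ← h2]
  refine Finset.sum_congr rfl fun j _ => ?_
  simp only [mat, Matrix.of_apply]
  have hsingle : (Pi.single j 1 : Fin (P.rank (n + 1)) → MonoidAlgebra ℚ Γ) =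
      fun j' => if j = j' then 1 else 0 := by
    ext1 j'
    rw [Pi.single_apply]
    exact if_congr eq_comm rfl rfl
  rw [hsingle]

theorem mat_mul_prevMat (n : ℕ) : P.mat n * P.prevMat n = 0 := by
  cases n with
  | zero => exact Matrix.mul_zero _
  | succ n => exact P.mat_mul_mat n

theorem prevMat_conjTranspose_mul_mat_conjTranspose (n : ℕ) :
    (P.prevMat n).conjTranspose * (P.mat n).conjTranspose = 0 := by
  ext1 i j
  let starHom : MonoidAlgebra ℂ Γ →+ MonoidAlgebra ℂ Γ :=
    ⟨⟨star, groupAlgebra_star_zero Γ⟩, groupAlgebra_star_add⟩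
  have h := congrArg starHom (congrFun (congrFun (P.mat_mul_prevMat n) j) i)
  rw [Matrix.mul_apply, map_sum] at h
  rw [Matrix.mul_apply]
  refine Eq.trans (Finset.sum_congr rfl fun k _ => ?_) (h.trans (map_zero starHom))
  exact (groupAlgebra_star_mul _ _).symm

section Coefficients

variable {R : Type*} [Ring R] (f : MonoidAlgebra ℂ Γ →+* R)
variable (V : Type*) [AddCommGroup V] [Module R V]

theorem coboundaries_eq_range (n : ℕ) :
    P.coboundaries f V n = (matrixAct V ((P.prevMat n).map f)).range := by
  cases n with
  | zero =>
    symm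
    rw [coboundaries, AddMonoidHom.range_eq_bot_iff]
    refine AddMonoidHom.ext fun v => ?_
    rw [prevMat, Matrix.map_zero _ (map_zero f), matrixAct_zero]
    rfl
  | succ n => rfl

theorem cycles_eq_ker (n : ℕ) :
    P.cycles f V n = (matrixAct V ((P.prevMat n).conjTranspose.map f)).ker := by
  cases n with
  | zero =>
    rw [cycles, eq_comm, eq_top_iff]
    intro v _
    exact Subsingleton.elim (α := Fin 0 → V) _ _
  | succ n => rfl

theorem coboundaries_le_cocycles (n : ℕ) : P.coboundaries f V n ≤ P.cocycles f V n := by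
  rw [coboundaries_eq_range]
  rintro _ ⟨x, rfl⟩
  change matrixAct V _ (matrixAct V _ x) = 0
  rw [← matrixAct_mul, ← Matrix.map_mul, mat_mul_prevMat, Matrix.map_zero _ (map_zero f),
    matrixAct_zero]

theorem boundaries_le_cycles (n : ℕ) : P.boundaries f V n ≤ P.cycles f V n := by
  rw [cycles_eq_ker]
  rintro _ ⟨x, rfl⟩
  change matrixAct V _ (matrixAct V _ x) = 0
  rw [← matrixAct_mul, ← Matrix.map_mul, prevMat_conjTranspose_mul_mat_conjTranspose,
    Matrix.map_zero _ (map_zero f), matrixAct_zero]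

theorem subsingleton_cohomology_iff (n : ℕ) :
    Subsingleton (P.Cohomology f V n) ↔
      (matrixAct V ((P.mat n).map f)).ker ≤ (matrixAct V ((P.prevMat n).map f)).range := by
  rw [subsingleton_quotient_addSubgroupOf_iff, coboundaries_eq_range]
  rfl

theorem subsingleton_homology_iff (n : ℕ) :
    Subsingleton (P.Homology f V n) ↔
      (matrixAct V ((P.prevMat n).conjTranspose.map f)).ker ≤
        (matrixAct V ((P.mat n).conjTranspose.map f)).range := by
  rw [subsingleton_quotient_addSubgroupOf_iff, cycles_eq_ker]
  rfl

variable [TopologicalSpace V] [IsTopologicalAddGroup V]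

theorem subsingleton_reducedCohomology_iff (n : ℕ) :
    Subsingleton (P.ReducedCohomology f V n) ↔
      ((matrixAct V ((P.mat n).map f)).ker : Set (Fin (P.rank n) → V)) ⊆
        closure (matrixAct V ((P.prevMat n).map f)).range := by
  rw [subsingleton_reduced_quotient_iff (P.coboundaries_le_cocycles f V n), coboundaries_eq_range]
  rfl

theorem subsingleton_reducedHomology_iff (n : ℕ) :
    Subsingleton (P.ReducedHomology f V n) ↔
      ((matrixAct V ((P.prevMat n).conjTranspose.map f)).ker : Set (Fin (P.rank n) → V)) ⊆
        closure (matrixAct V ((P.mat n).conjTranspose.map f)).range := by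
  rw [subsingleton_reduced_quotient_iff (P.boundaries_le_cycles f V n), cycles_eq_ker]
  rfl

variable [ContinuousConstSMul R V] [T2Space V]

theorem t2Space_cohomology_succ_iff (n : ℕ) :
    T2Space (P.Cohomology f V (n + 1)) ↔
      IsClosed ((matrixAct V ((P.mat n).map f)).range : Set (Fin (P.rank (n + 1)) → V)) := by
  exact t2Space_quotient_addSubgroupOf_iff (P.coboundaries_le_cocycles f V (n + 1))
    (isClosed_eq (continuous_matrixAct V _) continuous_const)

theorem t2Space_homology_iff (n : ℕ) :
    T2Space (P.Homology f V n) ↔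
      IsClosed ((matrixAct V ((P.mat n).conjTranspose.map f)).range :
        Set (Fin (P.rank n) → V)) := by
  refine t2Space_quotient_addSubgroupOf_iff (P.boundaries_le_cycles f V n) ?_
  rw [cycles_eq_ker]
  exact isClosed_eq (continuous_matrixAct V _) continuous_const

/-- For `n = 0` both sides hold trivially: no `k` occurs on the left, and `V^0` is a point. -/
theorem t2Space_prev_homology_iff (n : ℕ) :
    (∀ k : ℕ, k + 1 = n → T2Space (P.Homology f V k)) ↔
      IsClosed ((matrixAct V ((P.prevMat n).conjTranspose.map f)).range :
        Set (Fin (P.prevRank n) → V)) := by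
  cases n with
  | zero =>
    refine iff_of_true (fun k hk => by omega) ?_
    have : Subsingleton (Fin (P.prevRank 0) → V) :=
      inferInstanceAs (Subsingleton (Fin 0 → V))
    exact isClosed_discrete _
  | succ n =>
    simp only [Nat.add_right_cancel_iff, forall_eq]
    exact P.t2Space_homology_iff f V n

end Coefficients

theorem conjTranspose_map {Γ A : Type*} [Group Γ] [Ring A] [StarRing A] [Algebra ℂ A]
    (φ : MonoidAlgebra ℂ Γ →⋆ₐ[ℂ] A) {k l : ℕ}
    (T : Matrix (Fin k) (Fin l) (MonoidAlgebra ℂ Γ)) :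
    T.conjTranspose.map φ = (T.map φ).conjTranspose := by
  ext i j
  exact map_star φ _

/-- Matrices acting on rows form the opposite of the matrix ring, and reversing products preserves
units. -/
theorem isUnit_vecMulLinear_iff {A : Type*} [Ring A] {q : ℕ} (L : Matrix (Fin q) (Fin q) A) :
    IsUnit (L.vecMulLinear : Module.End A (Fin q → A)) ↔ IsUnit L := by
  have hmul (X Y : Matrix (Fin q) (Fin q) A) :
      (X * Y).toLinearMapRight' = Y.toLinearMapRight' ∘ₗ X.toLinearMapRight' :=
    Matrix.toLinearMapRight'_mul X Y
  constructor
  · intro h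
    obtain ⟨T, h₁, h₂⟩ := isUnit_iff_exists.1 h
    obtain ⟨X, rfl⟩ := (Matrix.toLinearMapRight' (R := A) (m := Fin q) (n := Fin q)).surjective T
    refine isUnit_iff_exists.2 ⟨X, ?_, ?_⟩
    · apply Matrix.toLinearMapRight'.injective
      rw [hmul, Matrix.toLinearMapRight'_one]
      exact h₂
    · apply Matrix.toLinearMapRight'.injective
      rw [hmul, Matrix.toLinearMapRight'_one]
      exact h₁
  · intro h
    obtain ⟨X, h₁, h₂⟩ := isUnit_iff_exists.1 h
    refine isUnit_iff_exists.2 ⟨X.toLinearMapRight', ?_, ?_⟩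
    · exact (hmul X L).symm.trans (by rw [h₂, Matrix.toLinearMapRight'_one]; rfl)
    · exact (hmul L X).symm.trans (by rw [h₁, Matrix.toLinearMapRight'_one]; rfl)

/-- Row action reverses composition, so `d_n^* d_n` becomes `M M*` and `d_{n+1} d_{n+1}^*` becomes
`N* N`: the same matrix as the Laplacian of the cochain complex on columns. -/
theorem laplacian_eq_vecMulLinear {A : Type*} [Ring A] (φ : MonoidAlgebra ℂ Γ →+* A) (n : ℕ) :
    P.laplacian φ n = ((P.prevMat n).map φ * (P.prevMat n).conjTranspose.map φ +
      (P.mat n).conjTranspose.map φ * (P.mat n).map φ).vecMulLinear := by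
  cases n with
  | zero =>
    have h : (P.prevMat 0).map φ * (P.prevMat 0).conjTranspose.map φ = 0 := by
      rw [prevMat, Matrix.map_zero _ (map_zero φ), Matrix.zero_mul]
    rw [h, zero_add]
    refine LinearMap.ext fun v => ?_
    simp [laplacian, chainD, chainDAdj]
  | succ n =>
    refine LinearMap.ext fun v => ?_
    simp [laplacian, chainD, chainDAdj, prevMat]
    rfl

end FreeResolution

/-! ### Translation back to the conditions on (co)homology. -/

theorem lemma2 {Γ : Type v} [Group Γ] (P : FreeResolution Γ)
    {A : Type u} [CStarAlgebra A] (φ : MonoidAlgebra ℂ Γ →⋆ₐ[ℂ] A) (n : ℕ) :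
    List.TFAE [
      -- (1)
      IsUnit (P.laplacian (φ : MonoidAlgebra ℂ Γ →+* A) n),
      -- (2)
      ∀ (V : Type u) [NormedAddCommGroup V] [InnerProductSpace ℂ V] [CompleteSpace V]
        (π : A →⋆ₐ[ℂ] (V →L[ℂ] V)),
        Subsingleton
          (P.ReducedCohomology (π.comp φ : MonoidAlgebra ℂ Γ →+* (V →L[ℂ] V)) V n),
      -- (3)
      ∀ (V : Type u) [NormedAddCommGroup V] [InnerProductSpace ℂ V] [CompleteSpace V]
        (π : A →⋆ₐ[ℂ] (V →L[ℂ] V)),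
        Subsingleton (P.Cohomology (π.comp φ : MonoidAlgebra ℂ Γ →+* (V →L[ℂ] V)) V n),
      -- (4)
      ∀ (V : Type u) [NormedAddCommGroup V] [InnerProductSpace ℂ V] [CompleteSpace V]
        (π : A →⋆ₐ[ℂ] (V →L[ℂ] V)),
        Subsingleton (P.Cohomology (π.comp φ : MonoidAlgebra ℂ Γ →+* (V →L[ℂ] V)) V n) ∧
        T2Space (P.Cohomology (π.comp φ : MonoidAlgebra ℂ Γ →+* (V →L[ℂ] V)) V (n + 1)),
      -- (5)
      ∀ (V : Type u) [AddCommGroup V] [Module A V],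
        Subsingleton (P.Cohomology (φ : MonoidAlgebra ℂ Γ →+* A) V n),
      -- (6)
      Subsingleton (P.Cohomology (φ : MonoidAlgebra ℂ Γ →+* A) A n) ∧
        T2Space (P.Cohomology (φ : MonoidAlgebra ℂ Γ →+* A) A (n + 1)),
      -- (2')
      ∀ (V : Type u) [NormedAddCommGroup V] [InnerProductSpace ℂ V] [CompleteSpace V]
        (π : A →⋆ₐ[ℂ] (V →L[ℂ] V)),
        Subsingleton
          (P.ReducedHomology (π.comp φ : MonoidAlgebra ℂ Γ →+* (V →L[ℂ] V)) V n),
      -- (3')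
      ∀ (V : Type u) [NormedAddCommGroup V] [InnerProductSpace ℂ V] [CompleteSpace V]
        (π : A →⋆ₐ[ℂ] (V →L[ℂ] V)),
        Subsingleton (P.Homology (π.comp φ : MonoidAlgebra ℂ Γ →+* (V →L[ℂ] V)) V n),
      -- (4'); in degree `-1` homology is zero, hence Hausdorff
      ∀ (V : Type u) [NormedAddCommGroup V] [InnerProductSpace ℂ V] [CompleteSpace V]
        (π : A →⋆ₐ[ℂ] (V →L[ℂ] V)),
        Subsingleton (P.Homology (π.comp φ : MonoidAlgebra ℂ Γ →+* (V →L[ℂ] V)) V n) ∧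
        ∀ k : ℕ, k + 1 = n →
          T2Space (P.Homology (π.comp φ : MonoidAlgebra ℂ Γ →+* (V →L[ℂ] V)) V k),
      -- (5')
      ∀ (V : Type u) [AddCommGroup V] [Module A V],
        Subsingleton (P.Homology (φ : MonoidAlgebra ℂ Γ →+* A) V n),
      -- (6')
      Subsingleton (P.Homology (φ : MonoidAlgebra ℂ Γ →+* A) A n) ∧
        ∀ k : ℕ, k + 1 = n → T2Space (P.Homology (φ : MonoidAlgebra ℂ Γ →+* A) A k)] ∧
    -- (1) implies (7) and (7')
    (IsUnit (P.laplacian (φ : MonoidAlgebra ℂ Γ →+* A) n) →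
      ∀ (V : Type u) [NormedAddCommGroup V] [NormedSpace ℂ V] [CompleteSpace V]
        [Module A V] [IsScalarTower ℂ A V] [ContinuousConstSMul A V],
        T2Space (P.Cohomology (φ : MonoidAlgebra ℂ Γ →+* A) V (n + 1)) ∧
        ∀ k : ℕ, k + 1 = n →
          T2Space (P.Homology (φ : MonoidAlgebra ℂ Γ →+* A) V k)) := by

  set N := (P.mat n).map φ with hN
  set M := (P.prevMat n).map φ with hM
  have hcN : (P.mat n).conjTranspose.map φ = N.conjTranspose :=
    FreeResolution.conjTranspose_map φ _
  have hcM : (P.prevMat n).conjTranspose.map φ = M.conjTranspose :=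
    FreeResolution.conjTranspose_map φ _
  have hNM : N * M = 0 := by
    rw [hN, hM, ← Matrix.map_mul, P.mat_mul_prevMat, Matrix.map_zero _ (map_zero φ)]
  have hMN : M.conjTranspose * N.conjTranspose = 0 := by
    rw [← Matrix.conjTranspose_mul, hNM, Matrix.conjTranspose_zero]
  have hlap : IsUnit (P.laplacian (φ : MonoidAlgebra ℂ Γ →+* A) n) ↔
      IsUnit (M * M.conjTranspose + N.conjTranspose * N) := by
    rw [P.laplacian_eq_vecMulLinear, FreeResolution.isUnit_vecMulLinear_iff, ← hcN, ← hcM]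
    rfl
  -- Duality: the pair `(N*, M*)` has the same Laplacian up to the order of the summands.
  have hdual := isUnit_laplacian_tfae hMN
  rw [Matrix.conjTranspose_conjTranspose, Matrix.conjTranspose_conjTranspose, add_comm] at hdual
  have hcoh := isUnit_laplacian_tfae hNM
  have hmap {V : Type u} [NormedAddCommGroup V] [InnerProductSpace ℂ V] [CompleteSpace V]
      (π : A →⋆ₐ[ℂ] (V →L[ℂ] V)) {k l : ℕ} (T : Matrix (Fin k) (Fin l) (MonoidAlgebra ℂ Γ)) :
      T.map (π.comp φ : MonoidAlgebra ℂ Γ →+* (V →L[ℂ] V)) = (T.map φ).map π := rfl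
  have hmap' {k l : ℕ} (T : Matrix (Fin k) (Fin l) (MonoidAlgebra ℂ Γ)) :
      T.map (φ : MonoidAlgebra ℂ Γ →+* A) = T.map φ := rfl
  simp only [P.subsingleton_cohomology_iff, P.subsingleton_homology_iff,
    P.subsingleton_reducedCohomology_iff, P.subsingleton_reducedHomology_iff,
    P.t2Space_cohomology_succ_iff, P.t2Space_prev_homology_iff, hmap, hmap', hlap, hcN, hcM,
    ← hN, ← hM]
  refine ⟨?_, fun h V _ _ _ _ _ _ => ⟨?_, ?_⟩⟩
  · tfae_have 1 ↔ 2 := hcoh.out 0 1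
    tfae_have 1 ↔ 3 := hcoh.out 0 2
    tfae_have 1 ↔ 4 := hcoh.out 0 3
    tfae_have 1 ↔ 5 := hcoh.out 0 4
    tfae_have 1 ↔ 6 := hcoh.out 0 5
    tfae_have 1 ↔ 7 := hdual.out 0 1
    tfae_have 1 ↔ 8 := hdual.out 0 2
    tfae_have 1 ↔ 9 := hdual.out 0 3
    tfae_have 1 ↔ 10 := hdual.out 0 4
    tfae_have 1 ↔ 11 := hdual.out 0 5
    tfae_finish
  · exact (P.t2Space_cohomology_succ_iff _ V n).2
      (isClosed_range_of_isUnit_laplacian hNM hMN h V)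
  · rw [add_comm] at h
    refine (P.t2Space_prev_homology_iff _ V n).2 ?_
    rw [hmap', hcM]
    exact isClosed_range_of_isUnit_laplacian hMN hNM h V
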